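/- There are a number $d$ and parameter-free first-order formulas in the language $\{\le\}$ of partially ordered sets, fixed once and for all, that form a $d$-dimensional interpretation of $(\mathbb{N},+,\cdot)$ in $(L,\subseteq)$ for every algebraically closed field $K$ and every integer $n\ge 2$, where $L$ is the lattice of Zariski closed subsets of $K^n$ (the sets of common zeros in $K^n$ of sets of polynomials in $K[X_1,\dots,X_n]$), ordered by inclusion. This holds both for $\mathbb{N}=\{0,1,2,\dots\}$ and for $\mathbb{N}=\{1,2,3,\dots\}$. Here a $d$-dimensional interpretation without parameters is given by a formula $\partial(\bar x)$, a formula $\varepsilon(\bar x,\bar y)$ and formulas $\alpha(\bar x,\bar y,\bar z)$, $\mu(\bar x,\bar y,\bar z)$, where $\bar x,\bar y,\bar z$ are $d$-tuples of variables; it interprets $(\mathbb{N},+,\cdot)$ in $(L,\subseteq)$ if there is a surjective map $f:\{\bar a\in L^d : L\models\partial(\bar a)\}\to\mathbb{N}$ such that for all $\bar a,\bar b,\bar c$ in its domain $$f(\bar a)=f(\bar b)\iff L\models\varepsilon(\bar a,\bar b),$$ $$f(\bar a)+f(\bar b)=f(\bar c)\iff L\models\alpha(\bar a,\bar b,\bar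 c),$$ $$f(\bar a)\cdot f(\bar b)=f(\bar c)\iff L\models\mu(\bar a,\bar b,\bar c).$$ The formulas $\partial,\varepsilon,\alpha,\mu$ (and $d$) depend neither on $K$ nor on $n$. -/

import Mathlib

/-- A recipe for a `d`-dimensional interpretation, without parameters, of structures in the
language `L'` in structures in the language `L`: an `L`-formula for the domain, and an `L`-formula
for each unnested atomic formula of `L'`, that is for `y₀ = y₁`, for `F(y₀, …, y_{k-1}) = y_k` with
a function symbol `F` and for `R(y₀, …, y_{k-1})` with a relation symbol `R`. Each variable `yᵢ` is
replaced by the tuple of the `d` variables `(i, 0), …, (i, d - 1)`. The formulas do not mention any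
structure. -/
structure InterpretationScheme (L L' : FirstOrder.Language.{0, 0}) (d : ℕ) where
  domain : L.Formula (Fin d)
  equal : L.Formula (Fin 2 × Fin d)
  graph : ∀ k : ℕ, L'.Functions k → L.Formula (Fin (k + 1) × Fin d)
  rel : ∀ k : ℕ, L'.Relations k → L.Formula (Fin k × Fin d)

namespace InterpretationScheme

variable {L L' : FirstOrder.Language.{0, 0}} {d : ℕ}

/-- The set of `d`-tuples of `A` that the domain formula defines. -/
def Carrier (Γ : InterpretationScheme L L' d) (A : Type*) [L.Structure A] : Type _ :=
  {a : Fin d → A // Γ.domain.Realize a}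

/-- `Γ.IsCoordinateMap f`: the map `f` from the domain of `Γ` in `A` is onto `B`, and it pulls each
unnested atomic formula of `B` back to the formula that `Γ` assigns to it. -/
structure IsCoordinateMap (Γ : InterpretationScheme L L' d) {A B : Type*}
    [L.Structure A] [L'.Structure B] (f : Γ.Carrier A → B) : Prop where
  surjective : Function.Surjective f
  equal_iff : ∀ a : Fin 2 → Γ.Carrier A,
    f (a 0) = f (a 1) ↔ Γ.equal.Realize fun v => (a v.1).1 v.2
  graph_iff : ∀ (k : ℕ) (F : L'.Functions k) (a : Fin (k + 1) → Γ.Carrier A),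
    FirstOrder.Language.Structure.funMap F (fun i : Fin k => f (a i.castSucc)) =
      f (a (Fin.last k)) ↔ (Γ.graph k F).Realize fun v => (a v.1).1 v.2
  rel_iff : ∀ (k : ℕ) (R : L'.Relations k) (a : Fin k → Γ.Carrier A),
    FirstOrder.Language.Structure.RelMap R (fun i : Fin k => f (a i)) ↔
      (Γ.rel k R).Realize fun v => (a v.1).1 v.2

/-- The scheme `Γ` interprets the `L'`-structure `B` in the `L`-structure `A`. -/
def Interprets (Γ : InterpretationScheme L L' d) (A B : Type*)
    [L.Structure A] [L'.Structure B] : Prop :=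
  ∃ f : Γ.Carrier A → B, Γ.IsCoordinateMap f

end InterpretationScheme

/-- The function symbols of the language `{+, ·}`. -/
inductive ArithFunc : ℕ → Type
  | add : ArithFunc 2
  | mul : ArithFunc 2

/-- The first-order language `{+, ·}` with two binary function symbols. -/
def arithLanguage : FirstOrder.Language.{0, 0} :=
  ⟨ArithFunc, fun _ => Empty⟩

/-- The structure `(M, +, ·)`. -/
instance arithStructure (M : Type*) [Add M] [Mul M] : arithLanguage.Structure M where
  funMap := fun F =>
    match F with
    | .add => fun x => x 0 + x 1
    | .mul => fun x => x 0 * x 1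
  RelMap := fun R => nomatch R

/-- A subset of `Kⁿ` is Zariski closed if it is the set of common zeros of a set of polynomials
over `K`. -/
def IsZariskiClosed {K : Type*} [Field K] {n : ℕ} (V : Set (Fin n → K)) : Prop :=
  ∃ S : Set (MvPolynomial (Fin n) K), V = {x | ∀ p ∈ S, MvPolynomial.eval x p = 0}

/-- The Zariski closed subsets of `Kⁿ`; as a subtype of `Set (Fin n → K)` they are ordered by
inclusion. -/
abbrev ZariskiLattice (K : Type*) [Field K] (n : ℕ) : Type _ :=
  {V : Set (Fin n → K) // IsZariskiClosed V}

/-- The first-order structure `(L, ⊆)` on the Zariski closed subsets of `Kⁿ`, in the language whose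
only symbol is `≤`. -/
instance zariskiLatticeStructure (K : Type*) [Field K] (n : ℕ) :
    FirstOrder.Language.order.Structure (ZariskiLattice K n) :=
  FirstOrder.Language.orderStructure _

-- A number `k` is coded by the closed sets with `k` points. Finiteness is visible in the lattice: a
-- closed set is finite iff every irreducible closed set below it is a point. Sizes are compared
-- through a third closed set `d`. If each point of `A` lies on exactly one component of `d` and
-- each component contains exactly one point of `A`, then `A` has as many points as `d` has
-- components; if the same `d` serves `B`, then `A` and `B` have equal size. Sums are disjoint
-- unions. For a product, the components of some `d`, counted by `A`, cut a copy of `C` into copies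
-- of `B`.
--
-- That these conditions force the arithmetic identities is counting in a lattice
-- (`IsSum.atomCount_eq`, `IsProduct.atomCount_eq`). The converse needs enough curves, hence `n ≥
-- 2`: two points lie on an irreducible closed set that misses any finitely many others
-- (`exists_supPrime_through`), and parallel lines carry a rectangular grid. The predicates are
-- expressed by `≤` alone, by the same formula in every distributive lattice with bottom, so the
-- formulas depend on neither `K` nor `n`.

universe u

open FirstOrder

/-- The property `P` of families of elements of a distributive lattice with a least element is
defined in all such lattices by one formula in the language `{≤}`. -/
def UniformlyDefinable {α : Type}
    (P : ∀ (M : Type u) [DistribLattice M] [OrderBot M], (α → M) → Prop) : Prop :=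
  ∃ φ : Language.order.Formula α, ∀ (M : Type u) [DistribLattice M] [OrderBot M] (v : α → M),
    @Language.Formula.Realize Language.order M (Language.orderStructure M) α φ v ↔ P M v

/-! ### Closure properties of uniform definability -/

namespace UniformlyDefinable

variable {α : Type}
  {P Q : ∀ (M : Type u) [DistribLattice M] [OrderBot M], (α → M) → Prop}

theorem congr (h : ∀ (M : Type u) [DistribLattice M] [OrderBot M] (v : α → M), P M v ↔ Q M v)
    (hP : UniformlyDefinable P) : UniformlyDefinable Q := by
  obtain ⟨φ, hφ⟩ := hP
  exact ⟨φ, fun M _ _ v => (hφ M v).trans (h M v)⟩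

theorem le (i j : α) : UniformlyDefinable.{u} fun _ _ _ v => v i ≤ v j := by
  refine ⟨(Language.Term.var (.inl i) : Language.order.Term (α ⊕ Fin 0)).le (.var (.inl j)),
    fun M _ _ v => ?_⟩
  let := Language.orderStructure M
  have : Language.order.OrderedStructure M := ⟨fun _ => Iff.rfl⟩
  exact Language.Term.realize_le

theorem not (hP : UniformlyDefinable P) :
    UniformlyDefinable fun M _ _ v => ¬ P M v := by
  obtain ⟨φ, hφ⟩ := hP
  refine ⟨φ.not, fun M _ _ v => ?_⟩
  let := Language.orderStructure M
  exact Language.Formula.realize_not.trans (not_congr (hφ M v))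

theorem imp (hP : UniformlyDefinable P) (hQ : UniformlyDefinable Q) :
    UniformlyDefinable fun M _ _ v => P M v → Q M v := by
  obtain ⟨φ, hφ⟩ := hP
  obtain ⟨ψ, hψ⟩ := hQ
  refine ⟨φ.imp ψ, fun M _ _ v => ?_⟩
  let := Language.orderStructure M
  exact Language.Formula.realize_imp.trans (imp_congr (hφ M v) (hψ M v))

theorem and (hP : UniformlyDefinable P) (hQ : UniformlyDefinable Q) :
    UniformlyDefinable fun M _ _ v => P M v ∧ Q M v :=
  (hP.imp hQ.not).not.congr fun _ _ _ v => by tauto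

theorem or (hP : UniformlyDefinable P) (hQ : UniformlyDefinable Q) :
    UniformlyDefinable fun M _ _ v => P M v ∨ Q M v :=
  (hP.not.imp hQ).congr fun _ _ _ v => by tauto

theorem all {Q : ∀ (M : Type u) [DistribLattice M] [OrderBot M], (α → M) → M → Prop}
    (hQ : UniformlyDefinable fun M _ _ (w : α ⊕ Unit → M) =>
      Q M (fun i => w (.inl i)) (w (.inr ()))) :
    UniformlyDefinable fun M _ _ v => ∀ x, Q M v x := by
  obtain ⟨φ, hφ⟩ := hQ
  refine ⟨φ.iAlls Unit, fun M _ _ v => ?_⟩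
  let := Language.orderStructure M
  rw [Language.Formula.realize_iAlls]
  exact ⟨fun h x => (hφ M _).1 (h fun _ => x), fun h x => (hφ M _).2 (h (x ()))⟩

theorem ex {Q : ∀ (M : Type u) [DistribLattice M] [OrderBot M], (α → M) → M → Prop}
    (hQ : UniformlyDefinable fun M _ _ (w : α ⊕ Unit → M) =>
      Q M (fun i => w (.inl i)) (w (.inr ()))) :
    UniformlyDefinable fun M _ _ v => ∃ x, Q M v x :=
  (all (Q := fun M _ _ v x => ¬ Q M v x) hQ.not).not.congr fun M _ _ v => by simp

theorem eq (i j : α) : UniformlyDefinable.{u} fun _ _ _ v => v i = v j :=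
  ((le i j).and (le j i)).congr fun _ _ _ _ => le_antisymm_iff.symm

/-- Unfolding `∃!` uses the formula of `Q` twice, the second time under one more quantifier; `hQ`
and `hQ'` supply the two variable contexts. -/
theorem existsUnique
    {Q : ∀ (M : Type u) [DistribLattice M] [OrderBot M], (α → M) → M → Prop}
    (hQ : UniformlyDefinable fun M _ _ (w : α ⊕ Unit → M) =>
      Q M (fun i => w (.inl i)) (w (.inr ())))
    (hQ' : UniformlyDefinable fun M _ _ (w : (α ⊕ Unit) ⊕ Unit → M) =>
      Q M (fun i => w (.inl (.inl i))) (w (.inr ()))) :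
    UniformlyDefinable fun M _ _ v => ∃! x, Q M v x :=
  ex (Q := fun M _ _ v x => Q M v x ∧ ∀ y, Q M v y → y = x) <| hQ.and <|
    all (Q := fun M _ _ (v : α ⊕ Unit → M) x =>
      Q M (fun i => v (Sum.inl i)) x → x = v (Sum.inr ())) <|
    hQ'.imp <| eq (Sum.inr ()) (Sum.inl (Sum.inr ()))

theorem sup_eq (i j k : α) : UniformlyDefinable.{u} fun _ _ _ v => v i ⊔ v j = v k := by
  -- A join is determined by its upper bounds, so its graph needs no term for `⊔`.
  refine congr (P := fun _ _ _ v => ∀ x, ((v i ≤ x ∧ v j ≤ x) → v k ≤ x) ∧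
    (v k ≤ x → (v i ≤ x ∧ v j ≤ x))) (fun _ _ _ v => ?_)
    (all ((((le _ _).and (le _ _)).imp (le _ _)).and ((le _ _).imp ((le _ _).and (le _ _)))))
  rw [eq_comm]
  simp_rw [← iff_def, ← sup_le_iff]
  exact ⟨fun h => le_antisymm ((h _).1 le_rfl) ((h _).2 le_rfl), fun h x => by rw [h]⟩

theorem inf_eq (i j k : α) : UniformlyDefinable.{u} fun _ _ _ v => v i ⊓ v j = v k := by
  refine congr (P := fun _ _ _ v => ∀ x, ((x ≤ v i ∧ x ≤ v j) → x ≤ v k) ∧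
    (x ≤ v k → (x ≤ v i ∧ x ≤ v j))) (fun _ _ _ v => ?_)
    (all ((((le _ _).and (le _ _)).imp (le _ _)).and ((le _ _).imp ((le _ _).and (le _ _)))))
  simp_rw [← iff_def, ← le_inf_iff]
  exact ⟨fun h => le_antisymm ((h _).1 le_rfl) ((h _).2 le_rfl), fun h x => by rw [h]⟩

theorem isMin (i : α) : UniformlyDefinable.{u} fun _ _ _ v => IsMin (v i) :=
  all (Q := fun _ _ _ v x => x ≤ v i → v i ≤ x) ((le _ _).imp (le _ _))

theorem isAtom (i : α) : UniformlyDefinable.{u} fun _ _ _ v => IsAtom (v i) := by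
  refine congr (P := fun _ _ _ v => ¬ IsMin (v i) ∧ ∀ x, x ≤ v i ∧ ¬ v i ≤ x → IsMin x)
    (fun _ _ _ v => ?_) ((isMin i).not.and (all (((le _ _).and (le _ _).not).imp (isMin _))))
  simp_rw [← lt_iff_le_not_ge, isMin_iff_eq_bot]
  rfl

theorem supPrime (i : α) : UniformlyDefinable.{u} fun _ _ _ v => SupPrime (v i) := by
  refine congr (P := fun _ _ _ v => ¬ IsMin (v i) ∧
    ∀ x, ∀ y, (∃ z, x ⊔ y = z ∧ v i ≤ z) → v i ≤ x ∨ v i ≤ y) (fun _ _ _ v => ?_)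
    ((isMin i).not.and (all (all
      ((ex ((sup_eq _ _ _).and (le _ _))).imp ((le _ _).or (le _ _))))))
  simp [SupPrime]

end UniformlyDefinable

/-! ### Lattice predicates that encode counting -/

section Counting

variable {M : Type u} [DistribLattice M] [OrderBot M]

/-- `z` is an irreducible component of `d`. -/
def IsComponent (z d : M) : Prop :=
  Maximal (fun y => SupPrime y ∧ y ≤ d) z

/-- All irreducible elements below `x` are atoms. -/
def IsFinitary (x : M) : Prop :=
  ∀ z, SupPrime z → z ≤ x → IsAtom z

/-- Each atom below `a` lies in exactly one component of `d`. -/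
def IsPartitioned (a d : M) : Prop :=
  ∀ p, IsAtom p → p ≤ a → ∃! z, IsComponent z d ∧ p ≤ z

/-- Incidence is a bijection between the atoms below `a` and the components of `d`. -/
def IsSelector (a d : M) : Prop :=
  IsPartitioned a d ∧ ∀ z, IsComponent z d → ∃! p, (IsAtom p ∧ p ≤ a) ∧ p ≤ z

/-- Two finitary elements have a common system of components that matches their atoms. -/
def Equipollent (a b : M) : Prop :=
  (IsFinitary a ∧ IsFinitary b) ∧ ∃ d, IsSelector a d ∧ IsSelector b d

/-- `c` is a disjoint join of copies of `a` and `b`. -/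
def IsSum (a b c : M) : Prop :=
  ∃ x, ∃ y, (Equipollent x a ∧ Equipollent y b) ∧ x ⊓ y = ⊥ ∧ x ⊔ y = c

/-- A copy of `c` is divided into copies of `b`, by as many components as `a` has atoms. -/
def IsProduct (a b c : M) : Prop :=
  ∃ x, ∃ y, ∃ d, (Equipollent x a ∧ Equipollent y c) ∧ (IsSelector x d ∧ IsPartitioned y d) ∧
    ∀ z, IsComponent z d → Equipollent (z ⊓ y) b

/-- The number of atoms below `a`. -/
noncomputable def atomCount (a : M) : ℕ :=
  {p | IsAtom p ∧ p ≤ a}.ncard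

end Counting

/-! ### Definability of the counting predicates -/

namespace UniformlyDefinable

variable {α : Type}

theorem isComponent (i j : α) : UniformlyDefinable.{u} fun _ _ _ v => IsComponent (v i) (v j) :=
  ((supPrime i).and (le i j)).and
    (all (Q := fun _ _ _ v y => SupPrime y ∧ y ≤ v j → v i ≤ y → y ≤ v i)
      (((supPrime _).and (le _ _)).imp ((le _ _).imp (le _ _))))

theorem isFinitary (i : α) : UniformlyDefinable.{u} fun _ _ _ v => IsFinitary (v i) :=
  all ((supPrime _).imp ((le _ _).imp (isAtom _)))

theorem isPartitioned (i j : α) :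
    UniformlyDefinable.{u} fun _ _ _ v => IsPartitioned (v i) (v j) :=
  all ((isAtom _).imp ((le _ _).imp
    (existsUnique ((isComponent _ _).and (le _ _)) ((isComponent _ _).and (le _ _)))))

theorem isSelector (i j : α) :
    UniformlyDefinable.{u} fun _ _ _ v => IsSelector (v i) (v j) :=
  (isPartitioned _ _).and (all ((isComponent _ _).imp (existsUnique
    (((isAtom _).and (le _ _)).and (le _ _)) (((isAtom _).and (le _ _)).and (le _ _)))))

theorem equipollent (i j : α) :
    UniformlyDefinable.{u} fun _ _ _ v => Equipollent (v i) (v j) :=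
  ((isFinitary _).and (isFinitary _)).and (ex ((isSelector _ _).and (isSelector _ _)))

theorem isSum (i j k : α) :
    UniformlyDefinable.{u} fun _ _ _ v => IsSum (v i) (v j) (v k) := by
  -- The language has no constant for `⊥`, so disjointness says that the meet is minimal.
  refine congr (P := fun _ _ _ v => ∃ x, ∃ y, (Equipollent x (v i) ∧ Equipollent y (v j)) ∧
    (∃ z, x ⊓ y = z ∧ IsMin z) ∧ x ⊔ y = v k) (fun _ _ _ v => ?_)
    (ex (ex (((equipollent _ _).and (equipollent _ _)).and
      ((ex ((inf_eq _ _ _).and (isMin _))).and (sup_eq _ _ _)))))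
  simp [IsSum]

theorem isProduct (i j k : α) :
    UniformlyDefinable.{u} fun _ _ _ v => IsProduct (v i) (v j) (v k) := by
  refine congr (P := fun _ _ _ v => ∃ x, ∃ y, ∃ d,
    (Equipollent x (v i) ∧ Equipollent y (v k)) ∧ (IsSelector x d ∧ IsPartitioned y d) ∧
    ∀ z, IsComponent z d → ∃ w, z ⊓ y = w ∧ Equipollent w (v j)) (fun _ _ _ v => ?_)
    (ex (ex (ex (((equipollent _ _).and (equipollent _ _)).and
      (((isSelector _ _).and (isPartitioned _ _)).and (all ((isComponent _ _).imp
        (ex ((inf_eq _ _ _).and (equipollent _ _))))))))))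
  simp [IsProduct]

end UniformlyDefinable

/-! ### The predicates force the arithmetic identities -/

section Counting

variable {M : Type u} [DistribLattice M] [OrderBot M]

/-- Each atom goes to the unique component above it; the unique atom in each component gives
injectivity and surjectivity. -/
theorem IsSelector.exists_equiv {a d : M} (h : IsSelector a d) :
    Nonempty ({p | IsAtom p ∧ p ≤ a} ≃ {z | IsComponent z d}) := by
  refine ⟨Equiv.ofBijective (fun p => ⟨_, (h.1 p.1 p.2.1 p.2.2).choose_spec.1.1⟩)
    ⟨fun p q e => ?_, fun ⟨z, hz⟩ => ?_⟩⟩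
  · have h1 := (h.1 p.1 p.2.1 p.2.2).choose_spec.1
    have h2 := (h.1 q.1 q.2.1 q.2.2).choose_spec.1
    have e' := congrArg Subtype.val e
    dsimp only at e'
    rw [← e'] at h2
    exact Subtype.ext ((h.2 _ h1.1).unique ⟨p.2, h1.2⟩ ⟨q.2, h2.2⟩)
  · obtain ⟨p, ⟨hp, hpz⟩, -⟩ := h.2 z hz
    exact ⟨⟨p, hp⟩, Subtype.ext
      ((h.1 p hp.1 hp.2).unique (h.1 p hp.1 hp.2).choose_spec.1 ⟨hz, hpz⟩)⟩

theorem IsSelector.atomCount_eq {a d : M} (h : IsSelector a d) :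
    atomCount a = {z | IsComponent z d}.ncard :=
  Nat.card_congr h.exists_equiv.some

theorem Equipollent.atomCount_eq {a b : M} (h : Equipollent a b) : atomCount a = atomCount b := by
  obtain ⟨-, d, h1, h2⟩ := h
  rw [h1.atomCount_eq, h2.atomCount_eq]

theorem IsAtom.supPrime {p : M} (hp : IsAtom p) : SupPrime p := by
  rw [supPrime_iff_supIrred]
  refine ⟨fun h => hp.1 h.eq_bot, fun b c h => ?_⟩
  rcases hp.le_iff.1 (h ▸ le_sup_left : b ≤ p) with hb | hb
  · right; simpa [hb] using h
  · left; exact hb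

/-- The descending chain condition writes `a` as a finite join of irreducibles, all atoms here. An
atom below `a` is prime, hence equals one of them. -/
theorem IsFinitary.finite_atoms [WellFoundedLT M] {a : M} (h : IsFinitary a) :
    {p | IsAtom p ∧ p ≤ a}.Finite := by
  obtain ⟨s, rfl, hs⟩ := exists_supIrred_decomposition a
  refine s.finite_toSet.subset fun p ⟨hp, hps⟩ => ?_
  obtain ⟨q, hq, hpq⟩ := hp.supPrime.le_finset_sup.1 hps
  have := h q (hs hq).supPrime (Finset.le_sup (f := id) hq)
  rcases this.le_iff.1 hpq with e | e
  · exact (hp.1 e).elim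
  · simpa [e] using hq

theorem atomCount_sup [WellFoundedLT M] {a b : M} (ha : IsFinitary a) (hb : IsFinitary b)
    (hab : a ⊓ b = ⊥) : atomCount (a ⊔ b) = atomCount a + atomCount b := by
  unfold atomCount
  rw [← Set.ncard_union_eq _ ha.finite_atoms hb.finite_atoms]
  · congr 1
    ext p
    constructor
    · rintro ⟨hp, h⟩
      exact (hp.supPrime.le_sup.1 h).imp (⟨hp, ·⟩) (⟨hp, ·⟩)
    · rintro (⟨hp, h⟩ | ⟨hp, h⟩)
      exacts [⟨hp, le_sup_of_le_left h⟩, ⟨hp, le_sup_of_le_right h⟩]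
  · rw [Set.disjoint_left]
    rintro p ⟨hp, h⟩ ⟨-, h'⟩
    exact hp.1 (le_bot_iff.1 (hab ▸ le_inf h h'))

theorem IsSum.atomCount_eq [WellFoundedLT M] {a b c : M} (h : IsSum a b c) :
    atomCount a + atomCount b = atomCount c := by
  obtain ⟨x, y, ⟨hx, hy⟩, hxy, rfl⟩ := h
  rw [atomCount_sup hx.1.1 hy.1.1 hxy, hx.atomCount_eq, hy.atomCount_eq]

theorem IsProduct.atomCount_eq [WellFoundedLT M] {a b c : M} (h : IsProduct a b c) :
    atomCount a * atomCount b = atomCount c := by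
  obtain ⟨x, y, d, ⟨hx, hy⟩, ⟨hxd, hyd⟩, hz⟩ := h
  rw [← hx.atomCount_eq, ← hy.atomCount_eq, hxd.atomCount_eq]
  have hyf := hy.1.1.finite_atoms
  have := hyf.to_subtype
  -- The atoms of `y` are fibred over the components of `d`, with the atoms of `z ⊓ y` as the fibre
  -- over `z`.
  let e : {p | IsAtom p ∧ p ≤ y} ≃
      Σ z : {z | IsComponent z d}, {p | IsAtom p ∧ p ≤ z.1 ⊓ y} :=
    { toFun := fun p => ⟨⟨_, (hyd p.1 p.2.1 p.2.2).choose_spec.1.1⟩,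
        ⟨p.1, p.2.1, le_inf (hyd p.1 p.2.1 p.2.2).choose_spec.1.2 p.2.2⟩⟩
      invFun := fun q => ⟨q.2.1, q.2.2.1, q.2.2.2.trans inf_le_right⟩
      left_inv := fun p => rfl
      right_inv := by
        rintro ⟨⟨z, hz⟩, ⟨p, hp, hpz⟩⟩
        have h := (hyd p hp (hpz.trans inf_le_right))
        obtain rfl := h.unique h.choose_spec.1 ⟨hz, hpz.trans inf_le_left⟩
        rfl }
  have hfin : Finite {z | IsComponent z d} :=
    have := hx.1.1.finite_atoms.to_subtype
    Finite.of_equiv _ hxd.exists_equiv.some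
  have : ∀ z : {z | IsComponent z d}, Finite {p | IsAtom p ∧ p ≤ z.1 ⊓ y} := fun z =>
    (hz z.1 z.2).1.1.finite_atoms.to_subtype
  have := Fintype.ofFinite {z | IsComponent z d}
  have key : ∀ z : {z | IsComponent z d}, Nat.card {p | IsAtom p ∧ p ≤ z.1 ⊓ y} = atomCount b :=
    fun z => (hz z.1 z.2).atomCount_eq
  rw [show atomCount y = _ from Nat.card_congr e, Nat.card_sigma, Finset.sum_congr rfl
    fun z _ => key z, Finset.sum_const, smul_eq_mul, Finset.card_univ, ← Nat.card_eq_fintype_card]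
  rfl

end Counting

/-! ### The lattice of Zariski closed sets and its points -/

namespace ZariskiLattice

section Field

variable {K : Type u} [Field K] {n : ℕ}

theorem isZariskiClosed_empty : IsZariskiClosed (∅ : Set (Fin n → K)) :=
  ⟨{1}, by ext; simp⟩

theorem isZariskiClosed_inter {V W : Set (Fin n → K)} (hV : IsZariskiClosed V)
    (hW : IsZariskiClosed W) : IsZariskiClosed (V ∩ W) := by
  obtain ⟨S, rfl⟩ := hV
  obtain ⟨T, rfl⟩ := hW
  refine ⟨S ∪ T, ?_⟩
  ext x
  simp [or_imp, forall_and]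

theorem isZariskiClosed_union {V W : Set (Fin n → K)} (hV : IsZariskiClosed V)
    (hW : IsZariskiClosed W) : IsZariskiClosed (V ∪ W) := by
  obtain ⟨S, rfl⟩ := hV
  obtain ⟨T, rfl⟩ := hW
  refine ⟨{r | ∃ p ∈ S, ∃ q ∈ T, p * q = r}, ?_⟩
  ext x
  constructor
  · rintro (h | h) _ ⟨p, hp, q, hq, rfl⟩
    · simp [h p hp]
    · simp [h q hq]
  · intro h
    by_contra hx
    simp only [Set.mem_union, Set.mem_ofPred_eq, not_or, not_forall] at hx
    obtain ⟨⟨p, hp, hpx⟩, q, hq, hqx⟩ := hx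
    have := h _ ⟨p, hp, q, hq, rfl⟩
    rw [map_mul] at this
    exact (mul_ne_zero hpx hqx) this

theorem isZariskiClosed_singleton (x : Fin n → K) : IsZariskiClosed {x} := by
  refine ⟨{p | ∃ j, p = MvPolynomial.X j - MvPolynomial.C (x j)}, ?_⟩
  ext y
  simp [sub_eq_zero, funext_iff]

theorem isZariskiClosed_of_finite {V : Set (Fin n → K)} (hV : V.Finite) : IsZariskiClosed V := by
  induction V, hV using Set.Finite.induction_on with
  | empty => exact isZariskiClosed_empty
  | insert _ _ ih => exact isZariskiClosed_union (isZariskiClosed_singleton _) ih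

instance : DistribLattice (ZariskiLattice K n) :=
  Subtype.distribLattice (fun _ _ => isZariskiClosed_union) (fun _ _ => isZariskiClosed_inter)

instance : OrderBot (ZariskiLattice K n) where
  bot := ⟨∅, isZariskiClosed_empty⟩
  bot_le V := Set.empty_subset V.1

theorem le_of_vanishingIdeal_le {V W : ZariskiLattice K n}
    (h : MvPolynomial.vanishingIdeal K V.1 ≤ MvPolynomial.vanishingIdeal K W.1) : W ≤ V := by
  obtain ⟨V, S, rfl⟩ := V
  intro x hx p hp
  exact h (show p ∈ MvPolynomial.vanishingIdeal K _ from fun y hy => hy p hp) x hx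

/-- A strictly smaller closed set has a strictly larger vanishing ideal, and the polynomial ring is
Noetherian. -/
instance : WellFoundedLT (ZariskiLattice K n) := by
  refine ⟨Subrelation.wf (r := InvImage (· > ·)
    fun V : ZariskiLattice K n => MvPolynomial.vanishingIdeal K V.1) (fun {V W} h => ?_)
    (InvImage.wf _ wellFounded_gt)⟩
  exact lt_of_le_not_ge (MvPolynomial.vanishingIdeal_anti_mono h.le)
    fun h' => h.not_ge (le_of_vanishingIdeal_le h')

/-- A point, as a Zariski closed set. -/
def point (x : Fin n → K) : ZariskiLattice K n := ⟨{x}, isZariskiClosed_singleton x⟩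

theorem point_le_iff {x : Fin n → K} {V : ZariskiLattice K n} : point x ≤ V ↔ x ∈ V.1 :=
  Set.singleton_subset_iff

theorem point_injective : Function.Injective (point : (Fin n → K) → ZariskiLattice K n) :=
  fun _ _ h => Set.singleton_injective (congrArg Subtype.val h)

theorem isAtom_iff {V : ZariskiLattice K n} : IsAtom V ↔ ∃ x, V = point x := by
  constructor
  · intro h
    obtain ⟨x, hx⟩ : V.1.Nonempty :=
      Set.nonempty_iff_ne_empty.2 fun h0 => h.1 (Subtype.ext h0)
    refine ⟨x, ?_⟩
    rcases h.le_iff.1 (point_le_iff.2 hx) with h | h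
    · exact ((Set.singleton_ne_empty x) (congrArg Subtype.val h)).elim
    · exact h.symm
  · rintro ⟨x, rfl⟩
    refine ⟨fun h => Set.singleton_ne_empty x (congrArg Subtype.val h), fun W hW => ?_⟩
    exact Subtype.ext (Set.ssubset_singleton_iff.1 hW)

theorem isAtom_point (x : Fin n → K) : IsAtom (point x) := isAtom_iff.2 ⟨x, rfl⟩

theorem atomCount_eq_ncard (V : ZariskiLattice K n) : atomCount V = V.1.ncard := by
  unfold atomCount
  rw [← Set.ncard_image_of_injective V.1 point_injective]
  congr 1
  ext p
  constructor
  · rintro ⟨hp, h⟩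
    obtain ⟨x, rfl⟩ := isAtom_iff.1 hp
    exact ⟨x, point_le_iff.1 h, rfl⟩
  · rintro ⟨x, hx, rfl⟩
    exact ⟨isAtom_point x, point_le_iff.2 hx⟩

theorem isFinitary_iff {V : ZariskiLattice K n} : IsFinitary V ↔ V.1.Finite := by
  constructor
  · intro h
    refine Set.Finite.of_finite_image (f := point) (h.finite_atoms.subset ?_)
      point_injective.injOn
    rintro _ ⟨x, hx, rfl⟩
    exact ⟨isAtom_point x, point_le_iff.2 hx⟩
  · intro h Z hZ hZV
    obtain ⟨x, hx⟩ : Z.1.Nonempty :=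
      Set.nonempty_iff_ne_empty.2 fun h0 => hZ.ne_bot (Subtype.ext h0)
    -- Subsets of a finite set are closed, so an irreducible `Z` with a second point would split as
    -- `{x}` and the rest.
    let W : ZariskiLattice K n :=
      ⟨Z.1 \ {x}, isZariskiClosed_of_finite ((h.subset hZV).subset Set.sdiff_subset)⟩
    have hle : Z ≤ point x ⊔ W := fun y hy => by
      by_cases hyx : y = x
      · exact Or.inl hyx
      · exact Or.inr ⟨hy, hyx⟩
    rcases hZ.le_sup.1 hle with h | h
    · exact isAtom_iff.2 ⟨x, le_antisymm h (point_le_iff.2 hx)⟩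
    · exact ((h hx).2 rfl).elim

theorem isPartitioned_iff {V D : ZariskiLattice K n} :
    IsPartitioned V D ↔ ∀ x ∈ V.1, ∃! Z, IsComponent Z D ∧ x ∈ Z.1 := by
  simp only [IsPartitioned, isAtom_iff, forall_exists_index, forall_eq_apply_imp_iff, point_le_iff]

theorem existsUnique_atom_iff {V Z : ZariskiLattice K n} :
    (∃! p, (IsAtom p ∧ p ≤ V) ∧ p ≤ Z) ↔ ∃! x, x ∈ V.1 ∧ x ∈ Z.1 := by
  constructor
  · rintro ⟨p, ⟨⟨hp, h1⟩, h2⟩, h⟩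
    obtain ⟨x, rfl⟩ := isAtom_iff.1 hp
    exact ⟨x, ⟨point_le_iff.1 h1, point_le_iff.1 h2⟩, fun y hy => point_injective
      (h _ ⟨⟨isAtom_point y, point_le_iff.2 hy.1⟩, point_le_iff.2 hy.2⟩)⟩
  · rintro ⟨x, ⟨h1, h2⟩, h⟩
    refine ⟨point x, ⟨⟨isAtom_point x, point_le_iff.2 h1⟩, point_le_iff.2 h2⟩, ?_⟩
    rintro p ⟨⟨hp, h3⟩, h4⟩
    obtain ⟨y, rfl⟩ := isAtom_iff.1 hp
    rw [h y ⟨point_le_iff.1 h3, point_le_iff.1 h4⟩]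

/-- The components of a finite join of pairwise incomparable irreducible sets. -/
theorem isComponent_finset_sup_iff {ι : Type*} {s : Finset ι} {Z : ι → ZariskiLattice K n}
    (hZ : ∀ i ∈ s, SupPrime (Z i)) (hinc : ∀ i ∈ s, ∀ j ∈ s, Z i ≤ Z j → i = j)
    {W : ZariskiLattice K n} : IsComponent W (s.sup Z) ↔ ∃ i ∈ s, W = Z i := by
  constructor
  · rintro ⟨⟨hW, hWs⟩, hmax⟩
    obtain ⟨i, hi, h⟩ := hW.le_finset_sup.1 hWs
    exact ⟨i, hi, le_antisymm h (hmax ⟨hZ i hi, Finset.le_sup hi⟩ h)⟩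
  · rintro ⟨i, hi, rfl⟩
    refine ⟨⟨hZ i hi, Finset.le_sup hi⟩, fun y hy hiy => ?_⟩
    obtain ⟨j, hj, h⟩ := hy.1.le_finset_sup.1 hy.2
    obtain rfl := hinc i hi j hj (hiy.trans h)
    exact h

/-- If each of finitely many irreducible sets contains its own point of `V`, and no other set
contains that point, then these sets are the components of their join. -/
theorem isSelector_finset_sup {ι : Type*} {s : Finset ι} {Z : ι → ZariskiLattice K n}
    {V : ZariskiLattice K n} {x : ι → Fin n → K} (hZ : ∀ i ∈ s, SupPrime (Z i))
    (hV : V.1 = x '' s) (hx : ∀ i ∈ s, ∀ j ∈ s, x i ∈ (Z j).1 ↔ i = j) :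
    IsSelector V (s.sup Z) := by
  have hc := fun W => isComponent_finset_sup_iff (W := W) hZ
    fun i hi j hj h => (hx i hi j hj).1 (h ((hx i hi i hi).2 rfl))
  refine ⟨isPartitioned_iff.2 fun y hy => ?_, fun W hW => existsUnique_atom_iff.2 ?_⟩
  · obtain ⟨i, hi, rfl⟩ := hV ▸ hy
    refine ⟨Z i, ⟨(hc _).2 ⟨i, hi, rfl⟩, (hx i hi i hi).2 rfl⟩, fun W ⟨hW, hiW⟩ => ?_⟩
    obtain ⟨j, hj, rfl⟩ := (hc W).1 hW
    rw [(hx i hi j hj).1 hiW]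
  · obtain ⟨i, hi, rfl⟩ := (hc W).1 hW
    refine ⟨x i, ⟨hV ▸ ⟨i, hi, rfl⟩, (hx i hi i hi).2 rfl⟩, fun y ⟨hy, hyi⟩ => ?_⟩
    obtain ⟨j, hj, rfl⟩ := hV ▸ hy
    rw [(hx j hj i hi).1 hyi]

/-! ### Irreducible curves -/

variable [Infinite K]

/-- The graph over the `i`-th coordinate axis of a tuple of polynomial functions is irreducible. -/
theorem exists_supPrime_graph (i : Fin n) (φ : Fin n → Polynomial K) (hφ : φ i = Polynomial.X) :
    ∃ Z : ZariskiLattice K n, SupPrime Z ∧ Z.1 = {x | ∀ j, x j = (φ j).eval (x i)} := by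
  have hcomp : ∀ (p : MvPolynomial (Fin n) K) (t : K),
      MvPolynomial.eval (fun j => (φ j).eval t) p = (MvPolynomial.aeval φ p).eval t := by
    intro p t
    induction p using MvPolynomial.induction_on with
    | C a => simp
    | add p q hp hq => simp [hp, hq]
    | mul_X p j hp => simp [hp]
  refine ⟨⟨{x | ∀ j, x j = (φ j).eval (x i)}, {p | ∃ j, p = MvPolynomial.X j -
    Polynomial.aeval (MvPolynomial.X i) (φ j)}, ?_⟩, ?_, rfl⟩
  · ext x
    have : ∀ q : Polynomial K, MvPolynomial.eval x (Polynomial.aeval (MvPolynomial.X i) q) =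
        q.eval (x i) := by
      intro q
      induction q using Polynomial.induction_on' with
      | add p q hp hq => simp [hp, hq]
      | monomial m a => simp
    simp [sub_eq_zero, this]
  · have hmem : ∀ t, (fun j => (φ j).eval t) ∈ {x : Fin n → K | ∀ j, x j = (φ j).eval (x i)} := by
      intro t j
      simp [hφ]
    refine ⟨fun h => ?_, fun V W hVW => ?_⟩
    · rw [isMin_iff_eq_bot] at h
      have h0 := hmem 0
      rw [show {x : Fin n → K | ∀ j, x j = (φ j).eval (x i)} = ∅ from congrArg Subtype.val h] at h0
      exact h0
    · obtain ⟨V, S, rfl⟩ := V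
      obtain ⟨W, T, rfl⟩ := W
      by_contra hcon
      rw [not_or] at hcon
      obtain ⟨h1, h2⟩ := hcon
      obtain ⟨x, hx, hxS⟩ := Set.not_subset.1 h1
      obtain ⟨y, hy, hyT⟩ := Set.not_subset.1 h2
      simp only [Set.mem_ofPred_eq, not_forall] at hxS hyT
      obtain ⟨p, hp, hpx⟩ := hxS
      obtain ⟨q, hq, hqy⟩ := hyT
      have hx' : x = fun j => (φ j).eval (x i) := funext hx
      have hy' : y = fun j => (φ j).eval (y i) := funext hy
      rw [hx', hcomp] at hpx
      rw [hy', hcomp] at hqy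
      -- Pulled back to the parameter line, `p` and `q` are nonzero in the domain `K[X]`. Yet their
      -- product vanishes at every `t`, because `V` and `W` cover the curve; `K` being infinite,
      -- this is absurd.
      have hne : MvPolynomial.aeval φ p * MvPolynomial.aeval φ q ≠ 0 := by
        refine mul_ne_zero (fun h => hpx ?_) (fun h => hqy ?_) <;> simp [h]
      refine hne (Polynomial.funext fun t => ?_)
      rw [Polynomial.eval_mul, Polynomial.eval_zero, ← hcomp, ← hcomp]
      rcases hVW (hmem t) with h | h
      · rw [h p hp, zero_mul]
      · rw [h q hq, mul_zero]

/-- In dimension at least two, two points lie on an irreducible closed set that avoids any finite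
set of further points. -/
theorem exists_supPrime_through (hn : 2 ≤ n) (a b : Fin n → K) {F : Set (Fin n → K)}
    (hF : F.Finite) : ∃ Z : ZariskiLattice K n, SupPrime Z ∧ a ∈ Z.1 ∧ b ∈ Z.1 ∧
      ∀ c ∈ F, c ∈ Z.1 → c = a ∨ c = b := by
  by_cases hab : a = b
  · subst hab
    exact ⟨point a, (isAtom_point a).supPrime, rfl, rfl, fun c _ hc => Or.inl hc⟩
  obtain ⟨i, hi⟩ := Function.ne_iff.1 hab
  have : Nontrivial (Fin n) := Fin.nontrivial_iff_two_le.2 hn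
  obtain ⟨k, hk⟩ := exists_ne i
  -- The line through `a` and `b`, parametrized by the coordinate `i`.
  let ℓ : Fin n → Polynomial K := fun j => Polynomial.C (a j) +
    Polynomial.C ((b j - a j) / (b i - a i)) * (Polynomial.X - Polynomial.C (a i))
  let q : Polynomial K := (Polynomial.X - Polynomial.C (a i)) * (Polynomial.X - Polynomial.C (b i))
  -- Since `q` vanishes at `a i` and `b i`, adding `r * q` in coordinate `k` keeps `a` and `b` on
  -- the curve. A point `c` with any other `c i` is hit for at most one `r`; when `q` vanishes at `c
  -- i`, division by zero only excludes `r = 0`, harmlessly.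
  obtain ⟨r, hr⟩ := (hF.image fun c => (c k - (ℓ k).eval (c i)) / q.eval (c i)).exists_notMem
  have hba : b i - a i ≠ 0 := sub_ne_zero.2 (Ne.symm hi)
  let φ : Fin n → Polynomial K := fun j =>
    if j = i then Polynomial.X else if j = k then ℓ k + Polynomial.C r * q else ℓ j
  obtain ⟨Z, hZ, hZe⟩ := exists_supPrime_graph i φ (by simp [φ])
  have hℓa : ∀ j, (ℓ j).eval (a i) = a j := fun j => by simp [ℓ]
  have hℓb : ∀ j, (ℓ j).eval (b i) = b j := fun j => by simp [ℓ, hba]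
  have hφa : ∀ j, a j = (φ j).eval (a i) := fun j => by
    by_cases h1 : j = i
    · simp [φ, h1]
    · by_cases h2 : j = k
      · subst h2; simp [φ, h1, hℓa, q]
      · simp [φ, h1, h2, hℓa]
  have hφb : ∀ j, b j = (φ j).eval (b i) := fun j => by
    by_cases h1 : j = i
    · simp [φ, h1]
    · by_cases h2 : j = k
      · subst h2; simp [φ, h1, hℓb, q]
      · simp [φ, h1, h2, hℓb]
  refine ⟨Z, hZ, hZe ▸ hφa, hZe ▸ hφb, fun c hc hcZ => ?_⟩
  rw [hZe] at hcZ
  by_cases hca : c i = a i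
  · left; funext j; rw [hcZ j, hca, ← hφa]
  by_cases hcb : c i = b i
  · right; funext j; rw [hcZ j, hcb, ← hφb]
  refine (hr ⟨c, hc, ?_⟩).elim
  have hq : q.eval (c i) ≠ 0 := by
    simp [q, sub_eq_zero, hca, hcb]
  have := hcZ k
  simp only [φ, if_neg hk, if_true, Polynomial.eval_add, Polynomial.eval_mul,
    Polynomial.eval_C] at this
  rw [div_eq_iff hq, this]
  ring

end Field

end ZariskiLattice

/-- Two finite sets with equally many elements are in a bijection that fixes their common
elements. -/
theorem exists_bijOn_fixing_inter {X : Type*} {A B : Set X} (hA : A.Finite) (hB : B.Finite)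
    (h : A.ncard = B.ncard) :
    ∃ σ : X → X, Set.BijOn σ A B ∧ ∀ a ∈ A, σ a = a ∨ a ∉ B ∧ σ a ∉ A := by
  classical
  rcases isEmpty_or_nonempty X with _ | _
  · exact ⟨id, by rw [Subsingleton.elim A B]; exact Set.bijOn_id B, fun a => isEmptyElim a⟩
  have hAB : (A \ B).ncard = (B \ A).ncard := by
    have h1 := Set.ncard_inter_add_ncard_sdiff_eq_ncard A B hA
    have h2 := Set.ncard_inter_add_ncard_sdiff_eq_ncard B A hB
    rw [Set.inter_comm] at h2
    omega
  obtain ⟨g, hg⟩ := (hA.subset Set.sdiff_subset : (A \ B).Finite).exists_bijOn_of_encard_eq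
    (t := B \ A) (by
      rw [← (hA.subset Set.sdiff_subset).cast_ncard_eq, hAB,
        (hB.subset Set.sdiff_subset).cast_ncard_eq])
  refine ⟨fun a => if a ∈ B then a else g a, ⟨fun a ha => ?_, fun a ha a' ha' e => ?_,
    fun b hb => ?_⟩, fun a ha => ?_⟩
  · by_cases h : a ∈ B
    · simp [h]
    · simpa [h] using (hg.mapsTo ⟨ha, h⟩).1
  · by_cases h : a ∈ B <;> by_cases h' : a' ∈ B <;> simp only [h, h', if_true, if_false] at e
    · exact e
    · exact ((hg.mapsTo ⟨ha', h'⟩).2 (e ▸ ha)).elim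
    · exact ((hg.mapsTo ⟨ha, h⟩).2 (e ▸ ha')).elim
    · exact hg.injOn ⟨ha, h⟩ ⟨ha', h'⟩ e
  · by_cases h : b ∈ A
    · exact ⟨b, h, by simp [hb]⟩
    · obtain ⟨a, ha, rfl⟩ := hg.surjOn ⟨hb, h⟩
      exact ⟨a, ha.1, by simp [ha.2]⟩
  · by_cases h : a ∈ B
    · simp [h]
    · right; simpa [h] using (hg.mapsTo ⟨ha, h⟩).2

/-! ### Every arithmetic identity has geometric witnesses -/

namespace ZariskiLattice

variable {K : Type u} [Field K] [Infinite K] {n : ℕ}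

theorem equipollent_iff (hn : 2 ≤ n) {A B : ZariskiLattice K n} (hA : A.1.Finite)
    (hB : B.1.Finite) : Equipollent A B ↔ A.1.ncard = B.1.ncard := by
  refine ⟨fun h => by rw [← atomCount_eq_ncard, ← atomCount_eq_ncard, h.atomCount_eq],
    fun h => ⟨⟨isFinitary_iff.2 hA, isFinitary_iff.2 hB⟩, ?_⟩⟩
  -- Join each `a` to `σ a` by a curve missing the rest of `A ∪ B`. If `σ` moved a point of `A` into
  -- `A`, that curve would contain two points of `A`; fixing common points prevents this, and
  -- likewise for `B`.
  obtain ⟨σ, hσ, hfix⟩ := exists_bijOn_fixing_inter hA hB h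
  choose Z hZ ha hb hZF using fun a => exists_supPrime_through hn a (σ a) (hA.union hB)
  refine ⟨hA.toFinset.sup Z, isSelector_finset_sup (x := id) (fun a _ => hZ a) (by simp) ?_,
    isSelector_finset_sup (x := σ) (fun a _ => hZ a) (by simp [hσ.image_eq]) ?_⟩
  · intro a h1 a' h2
    rw [Set.Finite.mem_toFinset] at h1 h2
    refine ⟨fun h => ?_, fun h => h ▸ ha a⟩
    rcases hZF a' a (Or.inl h1) h with e | e
    · exact e
    · change a = σ a' at e
      rcases hfix a' h2 with h3 | h3
      · rw [e, h3]
      · exact (h3.2 (e ▸ h1)).elim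
  · intro a h1 a' h2
    rw [Set.Finite.mem_toFinset] at h1 h2
    refine ⟨fun h => ?_, fun h => h ▸ hb a⟩
    rcases hZF a' (σ a) (Or.inr (hσ.mapsTo h1)) h with e | e
    · rcases hfix a' h2 with h3 | h3
      · exact hσ.injOn h1 h2 (e.trans h3.symm)
      · exact (h3.1 (e ▸ hσ.mapsTo h1)).elim
    · exact hσ.injOn h1 h2 e

theorem isSum_iff (hn : 2 ≤ n) {A B C : ZariskiLattice K n} (hA : A.1.Finite)
    (hB : B.1.Finite) (hC : C.1.Finite) :
    IsSum A B C ↔ A.1.ncard + B.1.ncard = C.1.ncard := by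
  refine ⟨fun h => by simpa only [atomCount_eq_ncard] using h.atomCount_eq, fun h => ?_⟩
  obtain ⟨S, hS, hSA⟩ := Set.exists_subset_card_eq (s := C.1) (n := A.1.ncard) (by omega)
  have hSf := hC.subset hS
  have hTf : (C.1 \ S).Finite := hC.subset Set.sdiff_subset
  have hT := Set.ncard_sdiff_add_ncard_of_subset hS hC
  refine ⟨⟨S, isZariskiClosed_of_finite hSf⟩, ⟨C.1 \ S, isZariskiClosed_of_finite hTf⟩,
    ⟨(equipollent_iff hn hSf hA).2 hSA, (equipollent_iff hn hTf hB).2 ?_⟩,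
    Subtype.ext (Set.inter_sdiff_self _ _), Subtype.ext (Set.union_sdiff_cancel hS)⟩
  dsimp only
  omega

theorem exists_ncard_eq (hn : 2 ≤ n) (k : ℕ) :
    ∃ V : ZariskiLattice K n, V.1.Finite ∧ V.1.ncard = k := by
  have : Nonempty (Fin n) := ⟨⟨0, by omega⟩⟩
  obtain ⟨s, hs⟩ := Infinite.exists_subset_card_eq (Fin n → K) k
  exact ⟨⟨s, isZariskiClosed_of_finite s.finite_toSet⟩, s.finite_toSet, by simp [hs]⟩

theorem isProduct_iff (hn : 2 ≤ n) {A B C : ZariskiLattice K n} (hA : A.1.Finite)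
    (hB : B.1.Finite) (hC : C.1.Finite) :
    IsProduct A B C ↔ A.1.ncard * B.1.ncard = C.1.ncard := by
  refine ⟨fun h => by simpa only [atomCount_eq_ncard] using h.atomCount_eq, fun h => ?_⟩
  let i : Fin n := ⟨0, by omega⟩
  let k : Fin n := ⟨1, by omega⟩
  have hki : k ≠ i := by simp [k, i]
  let e : ℕ ↪ K := Infinite.natEmbedding K
  -- In a coordinate plane, `s` names a line parallel to the axis `i` and `t` a position on it. The
  -- copy of `A` takes one point on each line, the copy of `C` takes `B.1.ncard` points on each.
  let pt : K → K → Fin n → K := fun s t j => if j = i then t else if j = k then s else 0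
  have pti : ∀ s t, pt s t i = t := fun s t => by simp [pt]
  have ptk : ∀ s t, pt s t k = s := fun s t => by simp [pt, hki]
  choose Z hZ hZe using fun s : K => exists_supPrime_graph (n := n) i
    (fun j => if j = i then Polynomial.X else if j = k then Polynomial.C s else 0) (by simp)
  have hmem : ∀ s t s', pt s t ∈ (Z s').1 ↔ s = s' := by
    intro s t s'
    rw [hZe]
    constructor
    · intro h
      simpa [ptk, hki] using h k
    · rintro rfl j
      by_cases h1 : j = i
      · simp [h1]
      · by_cases h2 : j = k
        · subst h2; simp [pt, h1]
        · simp [pt, h1, h2]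
  let R := Finset.range A.1.ncard
  let Q := Finset.range B.1.ncard
  have hinjX : Function.Injective fun m => pt (e m) (e 0) := fun m m' h =>
    e.injective (by simpa [ptk] using congrFun h k)
  have hinjY : Function.Injective fun m : ℕ × ℕ => pt (e m.1) (e m.2) := fun m m' h =>
    Prod.ext (e.injective (by simpa [ptk] using congrFun h k))
      (e.injective (by simpa [pti] using congrFun h i))
  have hXf : ((fun m => pt (e m) (e 0)) '' R).Finite := R.finite_toSet.image _
  have hYf : ((fun m : ℕ × ℕ => pt (e m.1) (e m.2)) '' (R ×ˢ Q : Finset (ℕ × ℕ))).Finite :=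
    (R ×ˢ Q).finite_toSet.image _
  let Y : ZariskiLattice K n := ⟨_, isZariskiClosed_of_finite hYf⟩
  have hxy : ∀ m ∈ R, ∀ m' ∈ R, pt (e m) (e 0) ∈ (Z (e m')).1 ↔ m = m' := fun m _ m' _ => by
    rw [hmem, e.injective.eq_iff]
  have hsel := isSelector_finset_sup (s := R) (Z := fun m => Z (e m))
    (V := ⟨_, isZariskiClosed_of_finite hXf⟩) (x := fun m => pt (e m) (e 0))
    (fun m _ => hZ (e m)) rfl hxy
  have hc := fun W => isComponent_finset_sup_iff (s := R) (Z := fun m => Z (e m)) (W := W)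
    (fun m _ => hZ (e m)) fun m hm m' hm' h => (hxy m hm m' hm').1 (h ((hxy m hm m hm).2 rfl))
  refine ⟨⟨_, isZariskiClosed_of_finite hXf⟩, Y, _, ⟨(equipollent_iff hn hXf hA).2 ?_,
    (equipollent_iff hn hYf hC).2 ?_⟩, ⟨hsel, isPartitioned_iff.2 ?_⟩, fun W hW => ?_⟩
  · rw [Set.ncard_image_of_injective _ hinjX]
    simp [R]
  · rw [Set.ncard_image_of_injective _ hinjY, ← h]
    simp only [Set.ncard_coe_finset, Finset.card_product, R, Q, Finset.card_range]
  · rintro _ ⟨⟨m, m'⟩, hm, rfl⟩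
    rw [Finset.mem_coe, Finset.mem_product] at hm
    refine ⟨Z (e m), ⟨(hc _).2 ⟨m, hm.1, rfl⟩, (hmem _ _ _).2 rfl⟩, fun W ⟨hW, hmW⟩ => ?_⟩
    obtain ⟨l, -, rfl⟩ := (hc W).1 hW
    rw [(hmem _ _ _).1 hmW]
  · obtain ⟨l, hl, rfl⟩ := (hc W).1 hW
    have hinj : Function.Injective fun m => pt (e l) (e m) := fun m m' h =>
      e.injective (by simpa [pti] using congrFun h i)
    have hZY : (Z (e l) ⊓ Y).1 = (fun m => pt (e l) (e m)) '' Q := by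
      ext x
      constructor
      · rintro ⟨hx, ⟨m, m'⟩, hm, rfl⟩
        rw [Finset.mem_coe, Finset.mem_product] at hm
        exact ⟨m', hm.2, congrArg (fun s => pt s (e m')) ((hmem _ _ _).1 hx).symm⟩
      · rintro ⟨m, hm, rfl⟩
        exact ⟨(hmem _ _ _).2 rfl, (l, m), Finset.mem_coe.2 (Finset.mem_product.2 ⟨hl, hm⟩), rfl⟩
    refine (equipollent_iff hn (hZY ▸ Q.finite_toSet.image _) hB).2 ?_
    rw [hZY, Set.ncard_image_of_injective _ hinj]
    simp [Q]

end ZariskiLattice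

/-! ### Assembly of the interpretation -/

/-- An interpretation of `(ℕ, +, ·)`, or of a part of it, in the lattices of Zariski closed sets:
a number `k` is represented by the closed sets with `k` elements. -/
theorem exists_interprets {B : Type} [Add B] [Mul B] (c : B → ℕ) (hc : Function.Injective c)
    (hadd : ∀ x y, c (x + y) = c x + c y) (hmul : ∀ x y, c (x * y) = c x * c y)
    {P : ∀ (M : Type u) [DistribLattice M] [OrderBot M], (Fin 1 → M) → Prop}
    (hP : UniformlyDefinable P)
    (hPc : ∀ (K : Type u) [Field K] [IsAlgClosed K] (n : ℕ) (v : Fin 1 → ZariskiLattice K n),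
      P (ZariskiLattice K n) v ↔ (v 0).1.Finite ∧ (v 0).1.ncard ∈ Set.range c) :
    ∃ (d : ℕ) (Γ : InterpretationScheme Language.order arithLanguage d),
      ∀ (K : Type u) [Field K] [IsAlgClosed K] (n : ℕ), 2 ≤ n →
        Γ.Interprets (ZariskiLattice K n) B := by
  obtain ⟨δ, hδ⟩ := hP
  obtain ⟨ε, hε⟩ := UniformlyDefinable.equipollent.{u} (α := Fin 2 × Fin 1) (0, 0) (1, 0)
  obtain ⟨σ, hσ⟩ := UniformlyDefinable.isSum.{u} (α := Fin 3 × Fin 1) (0, 0) (1, 0) (2, 0)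
  obtain ⟨π, hπ⟩ := UniformlyDefinable.isProduct.{u} (α := Fin 3 × Fin 1) (0, 0) (1, 0) (2, 0)
  refine ⟨1, ⟨δ, ε, fun k F => match F with | .add => σ | .mul => π, fun _ R => nomatch R⟩,
    fun K _ _ n hn => ?_⟩
  have : Infinite K := IsAlgClosed.instInfinite
  have hdom := fun v : Fin 1 → ZariskiLattice K n => (hδ _ v).trans (hPc K n v)
  -- A closed set goes to the element of `B` whose image under `c` is its cardinality; injectivity
  -- of `c` makes this unique.
  refine ⟨fun a => ((hdom a.1).1 a.2).2.choose, ⟨fun b => ?_, fun a => ?_, fun k F a => ?_,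
    fun _ R => nomatch R⟩⟩
  · obtain ⟨V, hV, hVb⟩ := ZariskiLattice.exists_ncard_eq (K := K) hn (c b)
    have h : δ.Realize fun _ : Fin 1 => V := (hdom _).2 ⟨hV, b, hVb.symm⟩
    exact ⟨⟨_, h⟩, hc (((hdom _).1 h).2.choose_spec.trans hVb)⟩
  · rw [← hc.eq_iff, ((hdom (a 0).1).1 (a 0).2).2.choose_spec,
      ((hdom (a 1).1).1 (a 1).2).2.choose_spec, ← ZariskiLattice.equipollent_iff hn
      ((hdom (a 0).1).1 (a 0).2).1 ((hdom (a 1).1).1 (a 1).2).1]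
    exact (hε (ZariskiLattice K n) fun v => (a v.1).1 v.2).symm
  · cases F with
    | add =>
      refine Iff.trans (hc.eq_iff.symm.trans ?_) (hσ (ZariskiLattice K n) _).symm
      refine Iff.trans ?_ (ZariskiLattice.isSum_iff hn ((hdom (a 0).1).1 (a 0).2).1
        ((hdom (a 1).1).1 (a 1).2).1 ((hdom (a 2).1).1 (a 2).2).1).symm
      rw [← ((hdom (a 0).1).1 (a 0).2).2.choose_spec, ← ((hdom (a 1).1).1 (a 1).2).2.choose_spec,
        ← ((hdom (a 2).1).1 (a 2).2).2.choose_spec, ← hadd]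
      rfl
    | mul =>
      refine Iff.trans (hc.eq_iff.symm.trans ?_) (hπ (ZariskiLattice K n) _).symm
      refine Iff.trans ?_ (ZariskiLattice.isProduct_iff hn ((hdom (a 0).1).1 (a 0).2).1
        ((hdom (a 1).1).1 (a 1).2).1 ((hdom (a 2).1).1 (a 2).2).1).symm
      rw [← ((hdom (a 0).1).1 (a 0).2).2.choose_spec, ← ((hdom (a 1).1).1 (a 1).2).2.choose_spec,
        ← ((hdom (a 2).1).1 (a 2).2).2.choose_spec, ← hmul]
      rfl

theorem mainTheorem6 :
    (∃ (d : ℕ) (Γ : InterpretationScheme FirstOrder.Language.order arithLanguage d),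
      ∀ (K : Type*) [Field K] [IsAlgClosed K] (n : ℕ), 2 ≤ n →
        Γ.Interprets (ZariskiLattice K n) ℕ) ∧
    (∃ (d : ℕ) (Γ : InterpretationScheme FirstOrder.Language.order arithLanguage d),
      ∀ (K : Type*) [Field K] [IsAlgClosed K] (n : ℕ), 2 ≤ n →
        Γ.Interprets (ZariskiLattice K n) ℕ+) := by
  constructor
  · refine exists_interprets id Function.injective_id (fun _ _ => rfl) (fun _ _ => rfl)
      (UniformlyDefinable.isFinitary 0) fun K _ _ n v => ?_
    simp [ZariskiLattice.isFinitary_iff]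
  · refine exists_interprets PNat.val PNat.coe_injective PNat.add_coe PNat.mul_coe
      ((UniformlyDefinable.isFinitary 0).and (UniformlyDefinable.isMin 0).not)
      fun K _ _ n v => ?_
    rw [ZariskiLattice.isFinitary_iff]
    refine and_congr_right fun h => ?_
    have hr : (v 0).1.ncard ∈ Set.range PNat.val ↔ 0 < (v 0).1.ncard :=
      ⟨fun ⟨k, hk⟩ => hk ▸ k.2, fun hk => ⟨⟨_, hk⟩, rfl⟩⟩
    rw [hr, Set.ncard_pos h, Set.nonempty_iff_ne_empty, isMin_iff_eq_bot]
    exact not_congr ⟨congrArg Subtype.val, fun h => Subtype.ext h⟩
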